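/- Let $n\ge 2$ and let $B_n$ be Artin's braid group, generated by $\sigma_1,\dots,\sigma_{n-1}$ subject to $\sigma_i\sigma_j=\sigma_j\sigma_i$ for $|i-j|\ge 2$ and $\sigma_i\sigma_{i+1}\sigma_i=\sigma_{i+1}\sigma_i\sigma_{i+1}$ for $1\le i\le n-2$. Let $\pi\colon B_n\to S_n$ be the homomorphism with $\pi(\sigma_i)=(i,i+1)$. A half-twist is an element of $B_n$ of the form $q^{-1}\sigma_1q$ with $q\in B_n$. A combed braid is a braid that can be drawn so that the strings $2,\dots,n$ are parallel and straight; in terms of diagrams, it is represented by a braid word in the letters $\sigma_i^{\pm1}$ in which every crossing involves the string that starts at position $1$, and in which this string also ends at position $1$. The combed braids form a subgroup $A_n$ of $B_n$, which is generated by the elements $a_i=\sigma_1\cdots\sigma_{i-1}\sigma_i^2\sigma_{i-1}^{-1}\cdots\sigma_1^{-1}$, $1\le i\le n-1$. Theorem. Let $b\in B_n$ and $k\in\mathbb Z$. Then $b=h^{2k}$ for some half-twist $h\in B_n$ with $\pi(h)=(1,n)$ if and only if $b$ is a combed braid that is conjugate in $A_n$ to $a_{n-1}^k$, that is, $b=P^{-1}a_{n-1}^kP$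 for some $P\in A_n$. -/

import Mathlib

/-- The defining relators of the braid group on `n` strings. The generators are indexed by
`Fin (n - 1)`; the index `i` (counted from `0`) stands for the generator usually written
`σ_{i+1}`. -/
def braidRels (n : ℕ) : Set (FreeGroup (Fin (n - 1))) :=
  {r | ∃ i j : Fin (n - 1), i.val + 2 ≤ j.val ∧
      r = (FreeGroup.of i * FreeGroup.of j) * (FreeGroup.of j * FreeGroup.of i)⁻¹} ∪
  {r | ∃ i j : Fin (n - 1), i.val + 1 = j.val ∧
      r = (FreeGroup.of i * FreeGroup.of j * FreeGroup.of i) *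
        (FreeGroup.of j * FreeGroup.of i * FreeGroup.of j)⁻¹}

/-- Artin's braid group on `n` strings. -/
abbrev BraidGroup (n : ℕ) : Type := PresentedGroup (braidRels n)

namespace BraidGroup

/-- The Artin generator which interchanges the strings at positions `i` and `i + 1`
(positions are `0, …, n - 1`). -/
def sigma {n : ℕ} (i : Fin (n - 1)) : BraidGroup n := PresentedGroup.of i

/-- The transposition of the positions `i` and `i + 1`. -/
def adjSwap {n : ℕ} (i : Fin (n - 1)) : Equiv.Perm (Fin n) :=
  Equiv.swap ⟨i.val, by omega⟩ ⟨i.val + 1, by omega⟩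

theorem adjSwap_rels {n : ℕ} :
    ∀ r ∈ braidRels n, FreeGroup.lift (adjSwap (n := n)) r = 1 := by
  rintro r (⟨⟨i, hi⟩, ⟨j, hj⟩, hij, rfl⟩ | ⟨⟨i, hi⟩, ⟨j, hj⟩, hij, rfl⟩)
  · simp only [map_mul, map_inv, FreeGroup.lift_apply_of]
    rw [mul_inv_eq_one]
    refine (Equiv.Perm.disjoint_swap_swap ?_).commute
    simp only at hij
    simp
    omega
  · simp only at hij
    subst hij
    simp only [map_mul, map_inv, FreeGroup.lift_apply_of]
    rw [mul_inv_eq_one]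
    have h1 : (⟨i, by omega⟩ : Fin n) ≠ ⟨i + 1, by omega⟩ := by simp
    have h2 : (⟨i, by omega⟩ : Fin n) ≠ ⟨i + 1 + 1, by omega⟩ := by simp; omega
    have h3 : (⟨i + 1, by omega⟩ : Fin n) ≠ ⟨i + 1 + 1, by omega⟩ := by simp
    have key : ∀ x y z : Fin n, x ≠ y → x ≠ z → y ≠ z →
        Equiv.swap x y * Equiv.swap y z * Equiv.swap x y =
          Equiv.swap y z * Equiv.swap x y * Equiv.swap y z := by
      intro x y z hxy hxz hyz
      rw [Equiv.swap_mul_swap_mul_swap hxy hxz, Equiv.swap_comm x y, Equiv.swap_comm y z,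
        Equiv.swap_mul_swap_mul_swap hyz.symm hxz.symm, Equiv.swap_comm]
    exact key _ _ _ h1 h2 h3

/-- The permutation induced by a braid: the homomorphism to the symmetric group that sends
each Artin generator to the transposition of the two adjacent positions. -/
def perm (n : ℕ) : BraidGroup n →* Equiv.Perm (Fin n) :=
  PresentedGroup.toGroup adjSwap_rels

/-- A half-twist is a conjugate of the first Artin generator. -/
def IsHalfTwist {n : ℕ} (hn : 2 ≤ n) (h : BraidGroup n) : Prop :=
  ∃ q : BraidGroup n, h = q⁻¹ * sigma ⟨0, by omega⟩ * q

/-- A braid word, i.e. a braid diagram read from top to bottom: the letter `(i, true)` is the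
crossing `σ` and the letter `(i, false)` the crossing `σ⁻¹` of the strings that are at that
height at the positions `i` and `i + 1`. -/
abbrev Word (n : ℕ) : Type := List (Fin (n - 1) × Bool)

/-- The braid represented by a braid word. -/
def ofWord {n : ℕ} (w : Word n) : BraidGroup n :=
  (w.map fun x => if x.2 then sigma x.1 else (sigma x.1)⁻¹).prod

/-- `OnlyMoves p w q`: in the diagram `w`, the string that starts at position `p` ends at
position `q` and takes part in every crossing of the diagram (over or under, in either
direction). So no two of the other strings cross: up to a planar isotopy they are parallel,
and this one string moves among them. -/
inductive OnlyMoves {n : ℕ} : ℕ → Word n → ℕ → Prop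
  | nil (p : ℕ) : OnlyMoves p [] p
  | right (i : Fin (n - 1)) (e : Bool) (w : Word n) (q : ℕ) (h : OnlyMoves (i.val + 1) w q) :
      OnlyMoves i.val ((i, e) :: w) q
  | left (i : Fin (n - 1)) (e : Bool) (w : Word n) (q : ℕ) (h : OnlyMoves i.val w q) :
      OnlyMoves (i.val + 1) ((i, e) :: w) q

/-- A combed braid: it can be drawn so that all strings but the first are parallel and
straight. That is, it has a diagram in which every crossing involves the first string, and
this string ends where it started (so that every other string also does). -/
def IsCombed {n : ℕ} (b : BraidGroup n) : Prop :=
  ∃ w : Word n, OnlyMoves 0 w 0 ∧ ofWord w = b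

theorem ofWord_append {n : ℕ} (v w : Word n) : ofWord (v ++ w) = ofWord v * ofWord w := by
  simp [ofWord]

theorem OnlyMoves.append {n : ℕ} {p q r : ℕ} {v w : Word n} (hv : OnlyMoves p v q)
    (hw : OnlyMoves q w r) : OnlyMoves p (v ++ w) r := by
  induction hv with
  | nil p => exact hw
  | right i e v q _ ih => exact .right i e _ _ (ih hw)
  | left i e v q _ ih => exact .left i e _ _ (ih hw)

theorem OnlyMoves.exists_inv {n : ℕ} {p q : ℕ} {w : Word n} (hw : OnlyMoves p w q) :
    ∃ v : Word n, OnlyMoves q v p ∧ ofWord v = (ofWord w)⁻¹ := by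
  induction hw with
  | nil p => exact ⟨[], .nil p, by simp [ofWord]⟩
  | right i e w q _ ih =>
    obtain ⟨v, hv, hvw⟩ := ih
    refine ⟨v ++ [(i, !e)], hv.append (.left i _ _ _ (.nil _)), ?_⟩
    rw [ofWord_append, hvw]
    cases e <;> simp [ofWord]
  | left i e w q _ ih =>
    obtain ⟨v, hv, hvw⟩ := ih
    refine ⟨v ++ [(i, !e)], hv.append (.right i _ _ _ (.nil _)), ?_⟩
    rw [ofWord_append, hvw]
    cases e <;> simp [ofWord]

/-- The group of combed braids. -/
def combed (n : ℕ) : Subgroup (BraidGroup n) where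
  carrier := {b | IsCombed b}
  one_mem' := ⟨[], .nil 0, by simp [ofWord]⟩
  mul_mem' := by
    rintro _ _ ⟨v, hv, rfl⟩ ⟨w, hw, rfl⟩
    exact ⟨v ++ w, hv.append hw, ofWord_append v w⟩
  inv_mem' := by
    rintro _ ⟨w, hw, rfl⟩
    exact hw.exists_inv

/-- The product of the first `p` Artin generators, in increasing order. -/
def initialProd (n p : ℕ) : BraidGroup n :=
  (((List.finRange (n - 1)).take p).map sigma).prod

/-- The combed braid in which the first string passes the strings in between, goes once around
the string at position `i + 1`, and comes back the same way: the conjugate of the square of the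
generator with index `i` by the product of all earlier generators. -/
def loop {n : ℕ} (i : Fin (n - 1)) : BraidGroup n :=
  initialProd n i.val * sigma i ^ 2 * (initialProd n i.val)⁻¹

theorem initialProd_succ {n : ℕ} (i : Fin (n - 1)) :
    initialProd n (i.val + 1) = initialProd n i.val * sigma i := by
  simp [initialProd, List.take_add_one]

theorem exists_initialProd {n p : ℕ} (hp : p ≤ n - 1) :
    ∃ w : Word n, OnlyMoves 0 w p ∧ ofWord w = initialProd n p := by
  induction p with
  | zero => exact ⟨[], .nil 0, by simp [ofWord, initialProd]⟩
  | succ p ih =>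
    obtain ⟨w, hw, h⟩ := ih (by omega)
    refine ⟨w ++ [(⟨p, by omega⟩, true)],
      hw.append (.right ⟨p, by omega⟩ true [] (p + 1) (.nil (p + 1))), ?_⟩
    rw [ofWord_append, h, initialProd_succ ⟨p, by omega⟩]
    simp [ofWord]

/-- The group of combed braids is generated by the braids `loop i`. -/
theorem combed_eq_closure (n : ℕ) :
    combed n = Subgroup.closure (Set.range (loop (n := n))) := by
  apply le_antisymm
  · have key : ∀ {p q : ℕ} {w : Word n}, OnlyMoves p w q →
        initialProd n p * ofWord w * (initialProd n q)⁻¹ ∈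
          Subgroup.closure (Set.range (loop (n := n))) := by
      intro p q w hw
      induction hw with
      | nil p => simp [ofWord]
      | right i e w q _ ih =>
        cases e
        · have h := mul_mem (inv_mem (Subgroup.subset_closure ⟨i, rfl⟩ :
            loop i ∈ Subgroup.closure (Set.range (loop (n := n))))) ih
          convert h using 1
          rw [initialProd_succ]
          simp [ofWord, loop]
          group
        · convert ih using 1
          rw [initialProd_succ]
          simp [ofWord, mul_assoc]
      | left i e w q _ ih =>
        cases e
        · convert ih using 1
          rw [initialProd_succ]
          simp [ofWord, mul_assoc]
        · have h := mul_mem (Subgroup.subset_closure ⟨i, rfl⟩ :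
            loop i ∈ Subgroup.closure (Set.range (loop (n := n)))) ih
          convert h using 1
          rw [initialProd_succ]
          simp [ofWord, loop, pow_two, mul_assoc]
    rintro _ ⟨w, hw, rfl⟩
    simpa [initialProd] using key hw
  · rw [Subgroup.closure_le]
    rintro _ ⟨i, rfl⟩
    obtain ⟨w, hw, h⟩ := exists_initialProd (n := n) (p := i.val) (by omega)
    obtain ⟨v, hv, h'⟩ := hw.exists_inv
    refine ⟨w ++ ([(i, true), (i, true)] ++ v),
      hw.append ((OnlyMoves.right i _ _ _ (.left i _ _ _ (.nil _))).append hv), ?_⟩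
    rw [ofWord_append, ofWord_append, h, h', h]
    simp [ofWord, loop, pow_two, mul_assoc]

end BraidGroup

/-!
Count positions and generators from `0`, and let `t_i` be the half-twist along the standard arc
from the first string to the string at `i + 1`, so that `t_i ^ 2 = loop i`. Write a half-twist `h`
with `perm n h = (0, n - 1)` as `q⁻¹ * t_{n-2} * q`; replacing `q` by `t_{n-2} * q` if necessary,
`q` fixes the position `0`. By a Schreier-type argument the braids fixing that position are
generated by the combed braids and the `sigma j` with `0 < j`, and each of these permutes by
conjugation the half-twists that are conjugate to some `t_i` in the group of combed braids. So `h`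
is conjugate in that group to some `t_i`, and the permutation of `h` forces `i = n - 2`.
-/

theorem conj_eq_inv_conj_of_braid {G : Type*} [Group G] {x s : G} (h : x * s * x = s * x * s) :
    x * s * x⁻¹ = s⁻¹ * x * s := by
  rw [mul_inv_eq_iff_eq_mul, mul_assoc, mul_assoc, eq_inv_mul_iff_mul_eq, ← mul_assoc, ← h,
    mul_assoc]

theorem apply_eq_or_eq_of_swap_apply_eq_swap {α : Type*} [DecidableEq α] {f : Equiv.Perm α}
    {a b : α} (hab : a ≠ b) (h : Equiv.swap (f a) (f b) = Equiv.swap a b) :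
    f a = a ∨ f a = b := by
  have hne : Equiv.swap a b (f a) ≠ f a := by
    rw [← h, Equiv.swap_apply_left]
    exact fun heq => hab (f.injective heq).symm
  exact (Equiv.swap_apply_ne_self_iff.1 hne).2

namespace BraidGroup

variable {n : ℕ}

theorem commute_sigma {i j : Fin (n - 1)} (h : i.val + 2 ≤ j.val) :
    Commute (sigma i : BraidGroup n) (sigma j) :=
  mul_inv_eq_one.1 (PresentedGroup.one_of_mem (rels := braidRels n) (Or.inl ⟨i, j, h, rfl⟩))

theorem sigma_braid {i j : Fin (n - 1)} (h : i.val + 1 = j.val) :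
    (sigma i * sigma j * sigma i : BraidGroup n) = sigma j * sigma i * sigma j :=
  mul_inv_eq_one.1 (PresentedGroup.one_of_mem (rels := braidRels n) (Or.inr ⟨i, j, h, rfl⟩))

theorem closure_range_sigma :
    Subgroup.closure (Set.range (sigma : Fin (n - 1) → BraidGroup n)) = ⊤ :=
  PresentedGroup.closure_range_of _

theorem perm_sigma (i : Fin (n - 1)) : perm n (sigma i) = adjSwap i :=
  PresentedGroup.toGroup.of _

theorem initialProd_zero : initialProd n 0 = 1 := rfl

theorem commute_sigma_initialProd {i : Fin (n - 1)} {p : ℕ} (h : p < i.val) :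
    Commute (sigma i) (initialProd n p) := by
  induction p with
  | zero => exact .one_right _
  | succ p ih =>
    rw [initialProd_succ ⟨p, by omega⟩]
    exact (ih (by omega)).mul_right (commute_sigma (by grind)).symm

theorem sigma_mul_initialProd {i j : Fin (n - 1)} (hij : i.val + 1 = j.val) {p : ℕ}
    (hjp : j.val < p) (hp : p ≤ n - 1) :
    sigma j * initialProd n p = initialProd n p * sigma i := by
  induction p, hjp using Nat.le_induction with
  | base =>
    have hcomm := (commute_sigma_initialProd (i := j) (p := i.val) (by omega)).eq
    calc sigma j * initialProd n (j.val + 1)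
        = sigma j * initialProd n i.val * (sigma i * sigma j) := by
          rw [initialProd_succ j, ← hij, initialProd_succ i, mul_assoc, mul_assoc]
      _ = initialProd n i.val * (sigma j * sigma i * sigma j) := by
          rw [hcomm]; simp only [mul_assoc]
      _ = initialProd n (j.val + 1) * sigma i := by
          rw [← sigma_braid hij, initialProd_succ j, ← hij, initialProd_succ i]
          simp only [mul_assoc]
  | succ p hjp ih =>
    have hcomm : Commute (sigma i : BraidGroup n) (sigma ⟨p, by omega⟩) :=
      commute_sigma (by simp only; omega)
    rw [initialProd_succ ⟨p, by omega⟩, ← mul_assoc, ih (by omega), mul_assoc, mul_assoc, hcomm.eq]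

theorem loop_mem_combed (i : Fin (n - 1)) : loop i ∈ combed n := by
  rw [combed_eq_closure]
  exact Subgroup.subset_closure ⟨i, rfl⟩

theorem perm_of_mem_combed {P : BraidGroup n} (hP : P ∈ combed n) : perm n P = 1 := by
  suffices combed n ≤ (perm n).ker from this hP
  rw [combed_eq_closure, Subgroup.closure_le]
  rintro _ ⟨i, rfl⟩
  simp [MonoidHom.mem_ker, loop, perm_sigma, adjSwap, pow_two]

/-- The half-twist along the standard arc from the first string to the string at position `i + 1`.
It is a square root of `loop i`. -/
def arcTwist (i : Fin (n - 1)) : BraidGroup n :=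
  initialProd n i.val * sigma i * (initialProd n i.val)⁻¹

theorem arcTwist_sq (i : Fin (n - 1)) : arcTwist i ^ 2 = loop i := conj_pow

theorem arcTwist_zero (h : 0 < n - 1) : arcTwist ⟨0, h⟩ = sigma ⟨0, h⟩ := by
  simp [arcTwist, initialProd_zero]

theorem arcTwist_succ {i j : Fin (n - 1)} (hij : i.val + 1 = j.val) :
    arcTwist j = arcTwist i * sigma j * (arcTwist i)⁻¹ := by
  have hcomm : (initialProd n i.val)⁻¹ * sigma j = sigma j * (initialProd n i.val)⁻¹ :=
    (commute_sigma_initialProd (by omega)).inv_right.eq.symm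
  calc arcTwist j
      = initialProd n i.val * sigma i * (sigma j * (initialProd n i.val)⁻¹) *
          initialProd n i.val * (sigma i)⁻¹ * (initialProd n i.val)⁻¹ := by
        rw [arcTwist, ← hij, initialProd_succ]; group
    _ = arcTwist i * sigma j * (arcTwist i)⁻¹ := by
        rw [← hcomm, arcTwist]; group

theorem arcTwist_braid {i j : Fin (n - 1)} (hij : i.val + 1 = j.val) :
    arcTwist i * sigma j * arcTwist i = sigma j * arcTwist i * sigma j := by
  have hj : sigma j = initialProd n i.val * sigma j * (initialProd n i.val)⁻¹ :=
    eq_mul_inv_of_mul_eq (commute_sigma_initialProd (by omega)).eq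
  rw [hj, arcTwist]
  simpa only [MulAut.conj_apply, map_mul] using
    congrArg (MulAut.conj (initialProd n i.val)) (sigma_braid hij)

theorem sigma_inv_conj_arcTwist_of_succ {i j : Fin (n - 1)} (hij : i.val + 1 = j.val) :
    (sigma j)⁻¹ * arcTwist i * sigma j = arcTwist j := by
  rw [arcTwist_succ hij, conj_eq_inv_conj_of_braid (arcTwist_braid hij)]

theorem sigma_conj_arcTwist_of_succ {i j : Fin (n - 1)} (hij : i.val + 1 = j.val) :
    sigma j * arcTwist i * (sigma j)⁻¹ = (loop i)⁻¹ * arcTwist j * loop i := by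
  rw [conj_eq_inv_conj_of_braid (arcTwist_braid hij).symm, arcTwist_succ hij, ← arcTwist_sq]
  group

theorem sigma_conj_arcTwist_self {i j : Fin (n - 1)} (hij : i.val + 1 = j.val) :
    sigma j * arcTwist j * (sigma j)⁻¹ = arcTwist i := by
  rw [← sigma_inv_conj_arcTwist_of_succ hij]
  group

theorem sigma_inv_conj_arcTwist_self {i j : Fin (n - 1)} (hij : i.val + 1 = j.val) :
    (sigma j)⁻¹ * arcTwist j * sigma j = loop j * arcTwist i * (loop j)⁻¹ := by
  have hloop : loop j = (sigma j)⁻¹ * loop i * sigma j := by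
    rw [← arcTwist_sq, ← arcTwist_sq, ← sigma_inv_conj_arcTwist_of_succ hij]
    simp only [pow_two]
    group
  calc (sigma j)⁻¹ * arcTwist j * sigma j
      = (sigma j)⁻¹ * (loop i * ((loop i)⁻¹ * arcTwist j * loop i) * (loop i)⁻¹) * sigma j := by
        group
    _ = loop j * arcTwist i * (loop j)⁻¹ := by
        rw [← sigma_conj_arcTwist_of_succ hij, hloop]; group

theorem commute_sigma_arcTwist {i j : Fin (n - 1)} (hj : 0 < j.val) (hij : i ≠ j)
    (hij' : i.val + 1 ≠ j.val) : Commute (sigma j) (arcTwist i) := by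
  rcases lt_or_gt_of_ne hij with h | h
  · have hcomm := commute_sigma_initialProd h
    exact (hcomm.mul_right (commute_sigma (by omega)).symm).mul_right hcomm.inv_right
  · let l : Fin (n - 1) := ⟨j.val - 1, by omega⟩
    have hl : l.val + 1 = j.val := Nat.sub_add_cancel hj
    have hj : sigma j = initialProd n i.val * sigma l * (initialProd n i.val)⁻¹ :=
      eq_mul_inv_of_mul_eq (sigma_mul_initialProd hl h (by omega))
    rw [hj, arcTwist, Commute.conj_iff]
    exact commute_sigma (by omega)

/-- The braids conjugate to a standard half-twist `arcTwist i` in the group of combed braids: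
the half-twists along the arcs that end at the first string. -/
def arcTwists (n : ℕ) : Set (BraidGroup n) :=
  {x | ∃ i, ∃ P ∈ combed n, x = P⁻¹ * arcTwist i * P}

theorem conj_mem_arcTwists {P x : BraidGroup n} (hP : P ∈ combed n) (hx : x ∈ arcTwists n) :
    P⁻¹ * x * P ∈ arcTwists n := by
  obtain ⟨i, Q, hQ, rfl⟩ := hx
  exact ⟨i, Q * P, mul_mem hQ hP, by group⟩

theorem arcTwist_mem_arcTwists (i : Fin (n - 1)) : arcTwist i ∈ arcTwists n :=
  ⟨i, 1, one_mem _, by simp⟩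

theorem sq_mem_combed_of_mem_arcTwists {x : BraidGroup n} (hx : x ∈ arcTwists n) :
    x ^ 2 ∈ combed n := by
  obtain ⟨i, P, hP, rfl⟩ := hx
  have hsq : (P⁻¹ * arcTwist i * P) ^ 2 = P⁻¹ * loop i * P := by
    rw [← arcTwist_sq]; simp only [pow_two]; group
  exact hsq ▸ mul_mem (mul_mem (inv_mem hP) (loop_mem_combed i)) hP

theorem conj_mem_combed_of_conj_arcTwist_mem {b : BraidGroup n}
    (hb : ∀ i, b⁻¹ * arcTwist i * b ∈ arcTwists n) {P : BraidGroup n} (hP : P ∈ combed n) :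
    b⁻¹ * P * b ∈ combed n := by
  suffices combed n ≤ (combed n).comap (MulAut.conj b⁻¹).toMonoidHom by simpa using this hP
  conv_lhs => rw [combed_eq_closure]
  rw [Subgroup.closure_le]
  rintro _ ⟨i, rfl⟩
  have h := sq_mem_combed_of_mem_arcTwists (hb i)
  simpa [← arcTwist_sq, pow_two, mul_assoc] using h

theorem conj_mem_arcTwists_of_conj_arcTwist_mem {b : BraidGroup n}
    (hb : ∀ i, b⁻¹ * arcTwist i * b ∈ arcTwists n) {x : BraidGroup n} (hx : x ∈ arcTwists n) :
    b⁻¹ * x * b ∈ arcTwists n := by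
  obtain ⟨i, P, hP, rfl⟩ := hx
  have h := conj_mem_arcTwists (conj_mem_combed_of_conj_arcTwist_mem hb hP) (hb i)
  convert h using 1
  group

theorem mem_normalizer_arcTwists {b : BraidGroup n}
    (hb : ∀ i, b⁻¹ * arcTwist i * b ∈ arcTwists n)
    (hb' : ∀ i, b * arcTwist i * b⁻¹ ∈ arcTwists n) :
    b ∈ Subgroup.normalizer (arcTwists n) := by
  refine Subgroup.mem_set_normalizer_iff''.2 fun x =>
    ⟨conj_mem_arcTwists_of_conj_arcTwist_mem hb, fun hx => ?_⟩
  have h := conj_mem_arcTwists_of_conj_arcTwist_mem (b := b⁻¹) (by simpa using hb') hx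
  simpa [mul_assoc] using h

theorem combed_le_normalizer_arcTwists : combed n ≤ Subgroup.normalizer (arcTwists n) := by
  refine fun P hP => mem_normalizer_arcTwists
    (fun i => conj_mem_arcTwists hP (arcTwist_mem_arcTwists i)) fun i => ?_
  simpa using conj_mem_arcTwists (inv_mem hP) (arcTwist_mem_arcTwists i)

theorem sigma_mem_normalizer_arcTwists {j : Fin (n - 1)} (hj : 0 < j.val) :
    sigma j ∈ Subgroup.normalizer (arcTwists n) := by
  obtain ⟨l, hl⟩ : ∃ l : Fin (n - 1), l.val + 1 = j.val :=
    ⟨⟨j.val - 1, by omega⟩, Nat.sub_add_cancel hj⟩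
  refine mem_normalizer_arcTwists (fun i => ?_) fun i => ?_ <;>
    rcases eq_or_ne i j with rfl | hij
  · rw [sigma_inv_conj_arcTwist_self hl]
    exact ⟨l, (loop i)⁻¹, inv_mem (loop_mem_combed i), by rw [inv_inv]⟩
  · rcases eq_or_ne (i.val + 1) j.val with hij' | hij'
    · exact sigma_inv_conj_arcTwist_of_succ hij' ▸ arcTwist_mem_arcTwists j
    · rw [(commute_sigma_arcTwist hj hij hij').inv_left.eq, inv_mul_cancel_right]
      exact arcTwist_mem_arcTwists i
  · exact sigma_conj_arcTwist_self hl ▸ arcTwist_mem_arcTwists l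
  · rcases eq_or_ne (i.val + 1) j.val with hij' | hij'
    · rw [sigma_conj_arcTwist_of_succ hij']
      exact ⟨j, loop i, loop_mem_combed i, rfl⟩
    · rw [(commute_sigma_arcTwist hj hij hij').eq, mul_inv_cancel_right]
      exact arcTwist_mem_arcTwists i

/-- The group of braids on all strings but the first. -/
def tailBraids (n : ℕ) : Subgroup (BraidGroup n) :=
  Subgroup.closure (sigma '' {j | 0 < j.val})

theorem sigma_mem_tailBraids {j : Fin (n - 1)} (hj : 0 < j.val) : sigma j ∈ tailBraids n :=
  Subgroup.subset_closure ⟨j, hj, rfl⟩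

theorem tailBraids_le_normalizer_arcTwists :
    tailBraids n ≤ Subgroup.normalizer (arcTwists n) := by
  rw [tailBraids, Subgroup.closure_le]
  rintro _ ⟨j, hj, rfl⟩
  exact sigma_mem_normalizer_arcTwists hj

theorem initialProd_mul_sigma_mul_inv_mem (i : Fin (n - 1)) (p : Fin n) :
    initialProd n (adjSwap i p) * sigma i * (initialProd n p)⁻¹ ∈ combed n ⊔ tailBraids n := by
  have htail {j : Fin (n - 1)} (hj : 0 < j.val) : sigma j ∈ combed n ⊔ tailBraids n :=
    le_sup_right (a := combed n) (sigma_mem_tailBraids hj)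
  rcases eq_or_ne p ⟨i.val, by omega⟩ with rfl | hi
  · rw [adjSwap, Equiv.swap_apply_left, initialProd_succ, mul_assoc (initialProd n _), ← pow_two]
    exact le_sup_left (b := tailBraids n) (loop_mem_combed i)
  rcases eq_or_ne p ⟨i.val + 1, by omega⟩ with rfl | hi'
  · rw [adjSwap, Equiv.swap_apply_right, initialProd_succ, mul_inv_cancel]
    exact one_mem _
  rw [adjSwap, Equiv.swap_apply_of_ne_of_ne hi hi']
  rw [ne_eq, Fin.ext_iff] at hi hi'
  rcases lt_or_gt_of_ne hi with h | h
  · rw [← (commute_sigma_initialProd h).eq, mul_inv_cancel_right]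
    exact htail (Nat.zero_lt_of_lt h)
  · have hip : i.val + 1 < p.val := lt_of_le_of_ne h (Ne.symm hi')
    rw [← sigma_mul_initialProd (j := ⟨i.val + 1, by omega⟩) rfl hip (by omega),
      mul_inv_cancel_right]
    exact htail i.val.succ_pos

/- The left-hand side is a cocycle in `q` for the action on positions, which reduces the claim to
the generators, as in Schreier's lemma. -/
theorem initialProd_mul_mul_inv_mem (q : BraidGroup n) (p : Fin n) :
    initialProd n (perm n q p) * q * (initialProd n p)⁻¹ ∈ combed n ⊔ tailBraids n := by
  have hq : q ∈ Subgroup.closure (Set.range (sigma : Fin (n - 1) → BraidGroup n)) :=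
    closure_range_sigma ▸ Subgroup.mem_top q
  induction hq using Subgroup.closure_induction generalizing p with
  | mem _ hσ =>
    obtain ⟨i, rfl⟩ := hσ
    exact perm_sigma i ▸ initialProd_mul_sigma_mul_inv_mem i p
  | one => simp
  | mul q r _ _ hq hr =>
    convert mul_mem (hq (perm n r p)) (hr p) using 1
    rw [map_mul, Equiv.Perm.mul_apply]
    group
  | inv q _ hq =>
    convert inv_mem (hq ((perm n q)⁻¹ p)) using 1
    rw [← Equiv.Perm.mul_apply, mul_inv_cancel, Equiv.Perm.one_apply, map_inv]
    group

theorem mem_combed_sup_tailBraids_of_perm_zero (hn : 0 < n) {q : BraidGroup n}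
    (hq : perm n q ⟨0, hn⟩ = ⟨0, hn⟩) : q ∈ combed n ⊔ tailBraids n := by
  simpa [hq, initialProd_zero] using initialProd_mul_mul_inv_mem q ⟨0, hn⟩

theorem IsHalfTwist.conj {hn : 2 ≤ n} {h : BraidGroup n} (hh : IsHalfTwist hn h)
    (q : BraidGroup n) : IsHalfTwist hn (q⁻¹ * h * q) := by
  obtain ⟨r, rfl⟩ := hh
  exact ⟨r * q, by group⟩

theorem IsHalfTwist.exists_eq_conj {hn : 2 ≤ n} {g h : BraidGroup n} (hh : IsHalfTwist hn h)
    (hg : IsHalfTwist hn g) : ∃ q, h = q⁻¹ * g * q := by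
  obtain ⟨r, rfl⟩ := hh
  obtain ⟨s, rfl⟩ := hg
  exact ⟨s⁻¹ * r, by group⟩

theorem isHalfTwist_arcTwist (hn : 2 ≤ n) (i : Fin (n - 1)) : IsHalfTwist hn (arcTwist i) := by
  obtain ⟨i, hi⟩ := i
  induction i with
  | zero => exact ⟨1, by simp [arcTwist_zero]⟩
  | succ i ih =>
    rw [← sigma_inv_conj_arcTwist_of_succ (i := ⟨i, by omega⟩) rfl]
    exact (ih _).conj _

/-- The transposition of the first position and the position `i + 1`. -/
def arcSwap (i : Fin (n - 1)) : Equiv.Perm (Fin n) :=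
  Equiv.swap ⟨0, i.pos.trans_le (Nat.sub_le n 1)⟩ ⟨i.val + 1, by omega⟩

theorem arcSwap_injective : Function.Injective (arcSwap (n := n)) := fun i j h => by
  simpa [Fin.ext_iff] using Equiv.swap_injective_of_left _ h

theorem adjSwap_mul_arcSwap_mul_inv {i j : Fin (n - 1)} (hij : i.val + 1 = j.val) :
    adjSwap j * arcSwap j * (adjSwap j)⁻¹ = arcSwap i := by
  have hzero : adjSwap j ⟨0, j.pos.trans_le (Nat.sub_le n 1)⟩ = ⟨0, by omega⟩ :=
    Equiv.swap_apply_of_ne_of_ne (by grind) (by grind)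
  have hsucc : adjSwap j ⟨j.val + 1, by omega⟩ = ⟨i.val + 1, by omega⟩ :=
    (Equiv.swap_apply_right _ _).trans (Fin.ext hij.symm)
  rw [arcSwap, ← Equiv.swap_apply_apply, hzero, hsucc, arcSwap]

theorem perm_arcTwist (i : Fin (n - 1)) : perm n (arcTwist i) = arcSwap i := by
  obtain ⟨i, hi⟩ := i
  induction i with
  | zero => exact (congrArg _ (arcTwist_zero hi)).trans (perm_sigma _)
  | succ i ih =>
    have hperm := congrArg (perm n)
      (sigma_conj_arcTwist_self (i := ⟨i, by omega⟩) (j := ⟨i + 1, hi⟩) rfl)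
    rw [ih, map_mul, map_mul, map_inv, perm_sigma,
      ← adjSwap_mul_arcSwap_mul_inv (j := ⟨i + 1, hi⟩) rfl] at hperm
    exact mul_left_cancel (mul_right_cancel hperm)

theorem IsHalfTwist.exists_eq_conj_arcTwist {hn : 2 ≤ n} {h : BraidGroup n}
    (hh : IsHalfTwist hn h) {i : Fin (n - 1)} (hperm : perm n h = arcSwap i) :
    ∃ q ∈ combed n ⊔ tailBraids n, h = q⁻¹ * arcTwist i * q := by
  obtain ⟨q, rfl⟩ := hh.exists_eq_conj (isHalfTwist_arcTwist hn i)
  have hconj : perm n q * arcSwap i * (perm n q)⁻¹ = arcSwap i := by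
    calc perm n q * arcSwap i * (perm n q)⁻¹
        = perm n q * perm n (q⁻¹ * arcTwist i * q) * (perm n q)⁻¹ := by rw [hperm]
      _ = perm n (arcTwist i) := by simp only [map_mul, map_inv]; group
      _ = arcSwap i := perm_arcTwist i
  rw [arcSwap, ← Equiv.swap_apply_apply] at hconj
  rcases apply_eq_or_eq_of_swap_apply_eq_swap (by simp) hconj with hzero | hsucc
  · exact ⟨q, mem_combed_sup_tailBraids_of_perm_zero _ hzero, rfl⟩
  · refine ⟨arcTwist i * q, mem_combed_sup_tailBraids_of_perm_zero (by omega) ?_, by group⟩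
    rw [map_mul, Equiv.Perm.mul_apply, hsucc, perm_arcTwist, arcSwap, Equiv.swap_apply_right]

theorem isHalfTwist_and_perm_eq_arcSwap_iff (hn : 2 ≤ n) (i : Fin (n - 1)) {h : BraidGroup n} :
    IsHalfTwist hn h ∧ perm n h = arcSwap i ↔ ∃ P ∈ combed n, h = P⁻¹ * arcTwist i * P := by
  have perm_conj {P : BraidGroup n} (hP : P ∈ combed n) (j : Fin (n - 1)) :
      perm n (P⁻¹ * arcTwist j * P) = arcSwap j := by
    rw [map_mul, map_mul, map_inv, perm_of_mem_combed hP, inv_one, one_mul, mul_one, perm_arcTwist]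
  constructor
  · rintro ⟨hh, hperm⟩
    obtain ⟨q, hq, rfl⟩ := hh.exists_eq_conj_arcTwist hperm
    have hnorm : q ∈ Subgroup.normalizer (arcTwists n) :=
      sup_le combed_le_normalizer_arcTwists tailBraids_le_normalizer_arcTwists hq
    obtain ⟨j, P, hP, hj⟩ :=
      (Subgroup.mem_set_normalizer_iff''.1 hnorm _).1 (arcTwist_mem_arcTwists i)
    rw [hj, perm_conj hP j] at hperm
    exact ⟨P, hP, arcSwap_injective hperm ▸ hj⟩
  · rintro ⟨P, hP, rfl⟩
    exact ⟨(isHalfTwist_arcTwist hn i).conj P, perm_conj hP i⟩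

theorem conj_arcTwist_zpow_two_mul (i : Fin (n - 1)) (P : BraidGroup n) (k : ℤ) :
    (P⁻¹ * arcTwist i * P) ^ (2 * k) = P⁻¹ * loop i ^ k * P := by
  have hconj := conj_zpow (i := 2 * k) (a := P⁻¹) (b := arcTwist i)
  rwa [inv_inv, zpow_mul (arcTwist i), zpow_ofNat, arcTwist_sq] at hconj

end BraidGroup

open BraidGroup

theorem theorem3p6_general {n : ℕ} (hn : 2 ≤ n) (i : Fin (n - 1)) (k : ℤ) (b : BraidGroup n) :
    (∃ h : BraidGroup n, IsHalfTwist hn h ∧ perm n h = arcSwap i ∧ b = h ^ (2 * k)) ↔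
      IsCombed b ∧ ∃ P ∈ combed n, b = P⁻¹ * loop i ^ k * P := by
  constructor
  · rintro ⟨h, hh, hperm, rfl⟩
    obtain ⟨P, hP, rfl⟩ := (isHalfTwist_and_perm_eq_arcSwap_iff hn i).1 ⟨hh, hperm⟩
    rw [conj_arcTwist_zpow_two_mul]
    exact ⟨mul_mem (mul_mem (inv_mem hP) (zpow_mem (loop_mem_combed i) k)) hP, P, hP, rfl⟩
  · rintro ⟨-, P, hP, rfl⟩
    obtain ⟨hh, hperm⟩ := (isHalfTwist_and_perm_eq_arcSwap_iff hn i).2 ⟨P, hP, rfl⟩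
    exact ⟨_, hh, hperm, (conj_arcTwist_zpow_two_mul i P k).symm⟩

theorem theorem3p6 (n : ℕ) (hn : 2 ≤ n) (k : ℤ) (b : BraidGroup n) :
    (∃ h : BraidGroup n, BraidGroup.IsHalfTwist hn h ∧
        BraidGroup.perm n h = Equiv.swap ⟨0, by omega⟩ ⟨n - 1, by omega⟩ ∧
        b = h ^ (2 * k)) ↔
      (BraidGroup.IsCombed b ∧
        ∃ P ∈ BraidGroup.combed n, b = P⁻¹ * BraidGroup.loop ⟨n - 2, by omega⟩ ^ k * P) := by
  have hlast : n - 2 + 1 = n - 1 := by omega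
  simpa only [arcSwap, hlast] using theorem3p6_general hn ⟨n - 2, by omega⟩ k b
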